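/- Let $\Gamma=\mathrm{SL}_2(\mathbb{Z})$ act on the hyperbolic plane $\mathbb{H}^2$ (upper half-plane with $ds^2=(dx^2+dy^2)/y^2$) by Möbius transformations. For an integer $N\ge 1$ let $\Gamma(N)=\ker\big(\mathrm{SL}_2(\mathbb{Z})\to\mathrm{SL}_2(\mathbb{Z}/N\mathbb{Z})\big)$, and put $S=\Gamma\backslash\mathbb{H}^2$ and $S_N=\Gamma(N)\backslash\mathbb{H}^2$, with the distance and the area measure induced from $\mathbb{H}^2$; the area of such a quotient is the hyperbolic area of a fundamental domain. For a hyperbolic surface $X$ let $\mathrm{sys}(X)$ be the infimum of the lengths of the non-contractible closed geodesics of $X$. An element $\gamma\in\Gamma(N)$ is said to represent a systole of $S_N$ if $\gamma$ translates along a geodesic line of $\mathbb{H}^2$ (its axis) and the projection of this axis to $S_N$, run through once from $z$ to $\gamma z$, is a non-contractible closed geodesic of length $\mathrm{sys}(S_N)$. Let $N\ge 5$. Then: (a) Every $\gamma\in\Gamma(N)$ with $|\mathrm{tr}(\gamma)|\ne 2$ satisfies $|\mathrm{tr}(\gamma)|\ge N^2-2$. (b) If $\beta\in\mathrm{SL}_2(\mathbb{Z})$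 has $\mathrm{tr}(\beta)=\pm N$, then $-\beta^2\in\Gamma(N)$ and $-\beta^2$ represents a systole of $S_N$. (c) $\Gamma(N)$ acts properly discontinuously and without fixed points on $\mathbb{H}^2$, and $S_N$ is a non-compact hyperbolic surface (a connected surface with a complete Riemannian metric locally isometric to $\mathbb{H}^2$) with $\mathrm{area}(S_N)<\mathrm{area}(S)\cdot N^3$. -/

import Mathlib

open scoped MatrixGroups UpperHalfPlane Topology

/-! ### The quotient of the hyperbolic plane by a subgroup of `SL(2, ℤ)` -/

/-- The quotient `Γ \ ℍ`, with the quotient topology. -/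
abbrev HypQuotient (Γ : Subgroup SL(2, ℤ)) : Type :=
  MulAction.orbitRel.Quotient Γ ℍ

namespace HypQuotient

variable {Γ : Subgroup SL(2, ℤ)}

/-- The projection `ℍ → Γ \ ℍ`. -/
noncomputable def proj (Γ : Subgroup SL(2, ℤ)) (z : ℍ) : HypQuotient Γ :=
  Quotient.mk _ z

/-- The distance between two points of `Γ \ ℍ`: the infimum of the hyperbolic distances between
their lifts to `ℍ`. -/
noncomputable def qdist (p q : HypQuotient Γ) : ℝ :=
  sInf {r : ℝ | ∃ z w : ℍ, proj Γ z = p ∧ proj Γ w = q ∧ dist z w = r}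

theorem proj_surjective (p : HypQuotient Γ) : ∃ z, proj Γ z = p :=
  Quotient.exists_rep p

theorem proj_eq_iff {z w : ℍ} : proj Γ z = proj Γ w ↔ ∃ g : Γ, g • w = z :=
  Quotient.eq.trans MulAction.orbitRel_apply

theorem dist_smul_smul (g : Γ) (z w : ℍ) : dist (g • z) (g • w) = dist z w := by
  have h : ∀ x : ℍ,
      g • x = (Matrix.SpecialLinearGroup.map (Int.castRingHom ℝ) (g : SL(2, ℤ))) • x :=
    fun x => rfl
  rw [h, h, dist_smul]

theorem qdist_bddBelow (p q : HypQuotient Γ) :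
    BddBelow {r : ℝ | ∃ z w : ℍ, proj Γ z = p ∧ proj Γ w = q ∧ dist z w = r} :=
  ⟨0, by rintro _ ⟨z, w, -, -, rfl⟩; exact dist_nonneg⟩

theorem qdist_nonneg (p q : HypQuotient Γ) : 0 ≤ qdist p q :=
  Real.sInf_nonneg (by rintro _ ⟨z, w, -, -, rfl⟩; exact dist_nonneg)

theorem qdist_proj_le (z w : ℍ) : qdist (proj Γ z) (proj Γ w) ≤ dist z w :=
  csInf_le (qdist_bddBelow _ _) ⟨z, w, rfl, rfl, rfl⟩

theorem exists_dist_lt {z : ℍ} {q : HypQuotient Γ} {r : ℝ} (h : qdist (proj Γ z) q < r) :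
    ∃ w, proj Γ w = q ∧ dist z w < r := by
  obtain ⟨w₀, hw₀⟩ := proj_surjective q
  obtain ⟨_, ⟨z', w, hz', hw, rfl⟩, hlt⟩ :=
    exists_lt_of_csInf_lt (by exact ⟨_, z, w₀, rfl, hw₀, rfl⟩) h
  obtain ⟨g, hg⟩ := proj_eq_iff.1 hz'.symm
  refine ⟨g • w, ?_, ?_⟩
  · rw [← hw]; exact proj_eq_iff.2 ⟨g, rfl⟩
  · rwa [← hg, dist_smul_smul]

theorem qdist_comm (p q : HypQuotient Γ) : qdist p q = qdist q p := by
  unfold qdist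
  congr 1
  ext r
  constructor <;> rintro ⟨z, w, hz, hw, h⟩ <;> exact ⟨w, z, hw, hz, by rw [dist_comm, h]⟩

theorem qdist_self (p : HypQuotient Γ) : qdist p p = 0 := by
  obtain ⟨z, rfl⟩ := proj_surjective p
  exact le_antisymm (by simpa using qdist_proj_le (Γ := Γ) z z) (qdist_nonneg _ _)

theorem qdist_triangle (p q s : HypQuotient Γ) : qdist p s ≤ qdist p q + qdist q s := by
  refine le_of_forall_pos_le_add fun ε hε => ?_
  obtain ⟨z, rfl⟩ := proj_surjective p
  obtain ⟨w, rfl, hw⟩ := exists_dist_lt (lt_add_of_pos_right (qdist (proj Γ z) q) (half_pos hε))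
  obtain ⟨v, rfl, hv⟩ := exists_dist_lt
    (lt_add_of_pos_right (qdist (proj Γ w) s) (half_pos hε))
  linarith [qdist_proj_le (Γ := Γ) z v, dist_triangle z w v]

theorem isOpen_iff_qdist (s : Set (HypQuotient Γ)) :
    IsOpen s ↔ ∀ p ∈ s, ∃ ε > 0, ∀ q, qdist p q < ε → q ∈ s := by
  have h : IsOpen s ↔ IsOpen (proj Γ ⁻¹' s) := isQuotientMap_quot_mk.isOpen_preimage.symm
  rw [h, Metric.isOpen_iff]
  constructor
  · intro H p hp
    obtain ⟨z, rfl⟩ := proj_surjective p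
    obtain ⟨ε, hε, hb⟩ := H z hp
    refine ⟨ε, hε, fun q hq => ?_⟩
    obtain ⟨w, rfl, hw⟩ := exists_dist_lt hq
    exact hb (by rwa [Metric.mem_ball, dist_comm])
  · intro H z hz
    obtain ⟨ε, hε, hb⟩ := H _ hz
    refine ⟨ε, hε, fun w hw => hb _ ?_⟩
    rw [Metric.mem_ball, dist_comm] at hw
    exact (qdist_proj_le z w).trans_lt hw

/-- The quotient distance on `Γ \ ℍ`; it induces the quotient topology. -/
noncomputable instance : PseudoMetricSpace (HypQuotient Γ) :=
  letI : Dist (HypQuotient Γ) := ⟨qdist⟩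
  PseudoMetricSpace.ofDistTopology qdist qdist_self qdist_comm qdist_triangle isOpen_iff_qdist

end HypQuotient

/-! ### Hyperbolic surfaces -/

/-- `X` is a hyperbolic surface: a connected, second countable Hausdorff space with a complete
length metric (stated in the form that any two points are joined by a minimizing geodesic segment)
and with an atlas of charts to `ℍ` that preserve distances and whose transition maps are locally
restrictions of isometries of `ℍ`. So `X` is a smooth surface whose distance comes from a complete
Riemannian metric locally isometric to the hyperbolic plane. -/
structure IsHyperbolicSurface (X : Type*) [PseudoMetricSpace X] : Prop where
  t2 : T2Space X
  secondCountable : SecondCountableTopology X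
  connected : ConnectedSpace X
  complete : CompleteSpace X
  exists_segment : ∀ p q : X, ∃ c : ℝ → X, c 0 = p ∧ c (dist p q) = q ∧
    ∀ s ∈ Set.Icc 0 (dist p q), ∀ t ∈ Set.Icc 0 (dist p q), dist (c s) (c t) = |s - t|
  exists_atlas : ∃ A : Set (OpenPartialHomeomorph X ℍ),
    (∀ x, ∃ e ∈ A, x ∈ e.source) ∧
    (∀ e ∈ A, ∀ x ∈ e.source, ∀ y ∈ e.source, dist (e x) (e y) = dist x y) ∧
    (∀ e ∈ A, ∀ e' ∈ A, ∀ z ∈ (e.symm.trans e').source,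
      ∃ g : ℍ ≃ᵢ ℍ, ∀ᶠ w in 𝓝 z, (e.symm.trans e') w = g w)

/-! ### Closed geodesics and systoles -/

/-- `α` is a closed geodesic of length `L`, parametrized by arc length: locally, the distance
between two points of the curve is the length of the arc between them. -/
def IsClosedGeodesic {X : Type*} [PseudoMetricSpace X] {L : ℝ} (α : C(AddCircle L, X)) : Prop :=
  0 < L ∧ ∀ t : ℝ, ∃ ε > 0, ∀ s ∈ Metric.ball t ε, ∀ s' ∈ Metric.ball t ε,
    dist (α (s : AddCircle L)) (α (s' : AddCircle L)) = |s - s'|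

/-- The systole of `X`: the infimum of the lengths of its non-contractible closed geodesics. -/
noncomputable def sys (X : Type*) [PseudoMetricSpace X] : ℝ :=
  sInf {L : ℝ | ∃ α : C(AddCircle L, X), IsClosedGeodesic α ∧ ¬ α.Nullhomotopic}

/-- The closed curve `α` in `Γ \ ℍ` is the projection of the axis of `γ`: there is a complete
geodesic `c` of `ℍ`, parametrized by arc length, along which `γ` translates by `L`, and `α` is its
image in `Γ \ ℍ`, run through once between `c t` and `γ • c t`. -/
def IsProjectedAxis {Γ : Subgroup SL(2, ℤ)} (γ : SL(2, ℤ)) {L : ℝ}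
    (α : C(AddCircle L, HypQuotient Γ)) : Prop :=
  ∃ c : ℝ → ℍ, Isometry c ∧ (∀ t, γ • c t = c (t + L)) ∧
    ∀ t : ℝ, α (t : AddCircle L) = HypQuotient.proj Γ (c t)

/-- `γ ∈ Γ` represents a systole of `Γ \ ℍ`: its axis projects to a non-contractible closed
geodesic whose length is the systole of `Γ \ ℍ`. -/
def RepresentsSystole (Γ : Subgroup SL(2, ℤ)) (γ : SL(2, ℤ)) : Prop :=
  γ ∈ Γ ∧ ∃ (L : ℝ) (α : C(AddCircle L, HypQuotient Γ)),
    IsProjectedAxis γ α ∧ IsClosedGeodesic α ∧ ¬ α.Nullhomotopic ∧ L = sys (HypQuotient Γ)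

/-! ### Area -/

/-- The image of `Γ` in the group of transformations of `ℍ` (where `1` and `-1` are identified). -/
noncomputable abbrev transformationGroup (Γ : Subgroup SL(2, ℤ)) : Subgroup (Equiv.Perm ℍ) :=
  (MulAction.toPermHom Γ ℍ).range

/-- The area of `Γ \ ℍ`: the hyperbolic area (for `dx dy / y ^ 2`) of a fundamental domain of the
group of transformations of `ℍ` given by `Γ`. -/
noncomputable def area (Γ : Subgroup SL(2, ℤ)) : ENNReal :=
  MeasureTheory.covolume (transformationGroup Γ) ℍ

/-!
For `γ ∈ Γ(N)` the entries of `1 - γ` are divisible by `N`, so `2 - tr γ = det (1 - γ)` is divisible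
by `N ^ 2`; this bounds the trace from below. For `tr β = ± N` the Cayley-Hamilton theorem gives
`-β ^ 2 = 1 - tr β • β`, an element of `Γ(N)` whose trace `2 - N ^ 2` attains the bound.

The displacement `d` of `γ` at any point satisfies `|tr γ| ≤ 2 cosh (d / 2)`, with equality on the
axis of `γ`. A closed geodesic of `Γ(N) \ ℍ` of length `L` lifts to a local geodesic of `ℍ` that is
translated by some `γ ∈ Γ(N)`, so that `|tr γ| ≤ 2 cosh (L / 2)`. Here `γ` is not parabolic (nor
trivial): otherwise it would preserve the height over its fixed point at infinity, and this height
would have a minimum along the lift, whereas no geodesic of `ℍ` has an interior minimum of the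
height. Hence `|tr γ| ≥ N ^ 2 - 2`, and `L` is at least the translation length of `-β ^ 2`.

For the area, translates of the fundamental domain of `SL(2, ℤ)` by coset representatives form a
fundamental domain of `Γ(N)`, so the area grows at most by the index, which is at most the order of
`SL(2, ℤ / N)`. That order is less than `N ^ 3`, since the first column of a matrix is one of
`N ^ 2 - 1` nonzero vectors and determines the second column up to adding a multiple of the first.
-/

/-! ### Displacement of Möbius transformations -/

section Matrices

variable {K : Type*} [Field K]

theorem specialLinearGroup_two_det_eq {R : Type*} [CommRing R] (g : SL(2, R)) :
    g 0 0 * g 1 1 - g 0 1 * g 1 0 = 1 := by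
  rw [← Matrix.det_fin_two, g.det_coe]

theorem exists_mul_eq_mul_diagonal_of_isRoot_charpoly {n : Type*} [Fintype n] [DecidableEq n]
    {A : Matrix n n K} {μ : n → K} (hμ : Function.Injective μ)
    (hA : ∀ i, A.charpoly.IsRoot (μ i)) :
    ∃ P : Matrix n n K, P.det ≠ 0 ∧ A * P = P * Matrix.diagonal μ := by
  have hev : ∀ i, Module.End.HasEigenvalue (Matrix.toLin' A) (μ i) := fun i => by
    rw [Module.End.hasEigenvalue_iff_isRoot_charpoly, Matrix.charpoly_toLin']
    exact hA i
  choose v hv using fun i => (hev i).exists_hasEigenvector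
  have hindep : LinearIndependent K v :=
    Module.End.eigenvectors_linearIndependent' _ μ hμ v hv
  refine ⟨(Matrix.of v).transpose, ?_, ?_⟩
  · rw [Matrix.det_transpose, ← isUnit_iff_ne_zero, ← Matrix.isUnit_iff_isUnit_det]
    exact Matrix.linearIndependent_rows_iff_isUnit.1 hindep
  · ext i j
    rw [Matrix.mul_diagonal, mul_comm]
    exact congrFun (hv j).apply_eq_smul i

theorem exists_mul_eq_mul_diag2 {g : SL(2, K)} {l : K} (hl : l ≠ 0) (hll : l ≠ l⁻¹)
    (htr : g.1.trace = l + l⁻¹) :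
    ∃ p : SL(2, K), g * p = p * Matrix.SpecialLinearGroup.diag2 l hl := by
  have hroot : ∀ i, g.1.charpoly.IsRoot (![l, l⁻¹] i) := fun i => by
    rw [Matrix.charpoly_fin_two, htr, g.det_coe]
    fin_cases i <;> simp [Polynomial.IsRoot] <;> field_simp <;> ring
  have hinj : Function.Injective ![l, l⁻¹] := by
    intro i j h
    fin_cases i <;> fin_cases j <;> simp_all [eq_comm]
  obtain ⟨P, hP, hgP⟩ := exists_mul_eq_mul_diagonal_of_isRoot_charpoly hinj hroot
  have hdet : (P * Matrix.diagonal ![P.det⁻¹, 1]).det = 1 := by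
    simp [Matrix.det_mul, hP]
  refine ⟨⟨_, hdet⟩, Subtype.ext ?_⟩
  change g.1 * (P * _) = P * _ * (Matrix.SpecialLinearGroup.diag2 l hl).1
  have hdiag : (Matrix.SpecialLinearGroup.diag2 l hl).1 = Matrix.diagonal ![l, l⁻¹] := by
    rw [Matrix.SpecialLinearGroup.diag2_coe']
    ext i j
    fin_cases i <;> fin_cases j <;> rfl
  rw [hdiag, ← mul_assoc, hgP, mul_assoc, mul_assoc, (Matrix.commute_diagonal _ _).eq]

end Matrices

section Displacement

open UpperHalfPlane

theorem im_specialLinearGroup_smul (g : SL(2, ℝ)) (z : ℍ) :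
    (g • z).im = z.im / Complex.normSq ((g 1 0 : ℂ) * z + g 1 1) := by
  rw [MulAction.compHom_smul_def, im_smul_eq_div_normSq]
  simp [denom]

theorem cosh_dist_smul (g : SL(2, ℝ)) (z : ℍ) :
    Real.cosh (dist z (g • z)) = 1 + Complex.normSq
      ((g 1 0 : ℂ) * z ^ 2 + ((g 1 1 : ℂ) - g 0 0) * z - g 0 1) / (2 * z.im ^ 2) := by
  have hd : (g 1 0 : ℂ) * z + g 1 1 ≠ 0 := denom_ne_zero (g : GL (Fin 2) ℝ) z
  have hn : Complex.normSq ((g 1 0 : ℂ) * z + g 1 1) ≠ 0 := by simpa using hd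
  have hsub : (z : ℂ) - (g • z : ℍ) =
      ((g 1 0 : ℂ) * z ^ 2 + ((g 1 1 : ℂ) - g 0 0) * z - g 0 1) / ((g 1 0 : ℂ) * z + g 1 1) := by
    rw [coe_specialLinearGroup_apply]
    simp only [Algebra.algebraMap_self, RingHom.id_apply]
    rw [eq_div_iff hd, sub_mul, div_mul_cancel₀ _ hd]
    ring
  rw [cosh_dist, Complex.dist_eq, ← Complex.normSq_eq_norm_sq, hsub, Complex.normSq_div,
    im_specialLinearGroup_smul]
  field_simp

theorem four_mul_sq_cosh_half_dist_smul (g : SL(2, ℝ)) (z : ℍ) :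
    4 * Real.cosh (dist z (g • z) / 2) ^ 2 = g.1.trace ^ 2 +
      ((g 1 0 * (z.re ^ 2 + z.im ^ 2) + (g 1 1 - g 0 0) * z.re - g 0 1) / z.im) ^ 2 := by
  have hhalf : 4 * Real.cosh (dist z (g • z) / 2) ^ 2 = 2 + 2 * Real.cosh (dist z (g • z)) := by
    rw [show dist z (g • z) = 2 * (dist z (g • z) / 2) by ring, Real.cosh_two_mul, Real.sinh_sq]
    ring_nf
  have hnormSq : Complex.normSq ((g 1 0 : ℂ) * z ^ 2 + ((g 1 1 : ℂ) - g 0 0) * z - g 0 1) =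
      (g 1 0 * (z.re ^ 2 - z.im ^ 2) + (g 1 1 - g 0 0) * z.re - g 0 1) ^ 2 +
      (2 * g 1 0 * z.re * z.im + (g 1 1 - g 0 0) * z.im) ^ 2 := by
    rw [Complex.normSq_apply]
    simp [pow_two]
    ring
  rw [hhalf, cosh_dist_smul, hnormSq, Matrix.trace_fin_two]
  field_simp
  linear_combination (-4 * z.im ^ 2) * specialLinearGroup_two_det_eq g

theorem abs_trace_le_two_mul_cosh_half_dist_smul (g : SL(2, ℝ)) (z : ℍ) :
    |g.1.trace| ≤ 2 * Real.cosh (dist z (g • z) / 2) := by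
  refine abs_le_of_sq_le_sq ?_ (by positivity)
  rw [mul_pow, show (2 : ℝ) ^ 2 = 4 by norm_num, four_mul_sq_cosh_half_dist_smul]
  exact le_add_of_nonneg_right (sq_nonneg _)

theorem abs_trace_lt_two_of_smul_eq {g : SL(2, ℝ)} (hg : g ∉ Subgroup.center SL(2, ℝ)) {z : ℍ}
    (hz : g • z = z) : |g.1.trace| < 2 := by
  have hell : (g : GL (Fin 2) ℝ).IsElliptic :=
    UpperHalfPlane.isElliptic_of_exists_smul_eq_self (by simp)
      (fun h => hg ((Matrix.SpecialLinearGroup.toGL_mem_center_iff _).1 h)) ⟨z, hz⟩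
  have hdiscr : g.1.trace ^ 2 - 4 * g.1.det < 0 := by
    rw [← Matrix.discr_fin_two]
    exact hell
  rw [g.det_coe] at hdiscr
  exact abs_lt_of_sq_lt_sq (by linarith) zero_le_two

/-! ### Axes of hyperbolic transformations -/

theorem specialLinearGroup_neg_smul (g : SL(2, ℝ)) (z : ℍ) : -g • z = g • z := by
  ext1
  simp only [coe_specialLinearGroup_apply, Matrix.SpecialLinearGroup.coe_neg, Matrix.neg_apply,
    map_neg, Complex.ofReal_neg, neg_mul, ← neg_add, neg_div_neg_eq]

theorem diag2_exp_smul_vertical_line (s t : ℝ) :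
    Matrix.SpecialLinearGroup.diag2 (Real.exp s) (Real.exp_ne_zero s) •
      (mk ⟨0, Real.exp t⟩ (Real.exp_pos t) : ℍ) =
      mk ⟨0, Real.exp (t + 2 * s)⟩ (Real.exp_pos _) := by
  ext1
  rw [coe_specialLinearGroup_apply, Matrix.SpecialLinearGroup.diag2_coe']
  apply Complex.ext
  · simp
  · simp [-Complex.ofReal_exp, Real.exp_add, two_mul]
    field_simp

theorem exists_axis {g : SL(2, ℝ)} (hg : 2 < |g.1.trace|) :
    ∃ (L : ℝ) (c : ℝ → ℍ), 0 < L ∧ 2 * Real.cosh (L / 2) = |g.1.trace| ∧ Isometry c ∧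
      ∀ t, g • c t = c (t + L) := by
  wlog hpos : 0 ≤ g.1.trace generalizing g
  · have htr : (-g).1.trace = -g.1.trace := Matrix.trace_neg g.1
    obtain ⟨L, c, hL⟩ := this (g := -g) (by rwa [htr, abs_neg]) (by rw [htr]; linarith)
    exact ⟨L, c, by simpa only [htr, abs_neg, specialLinearGroup_neg_smul] using hL⟩
  rw [abs_of_nonneg hpos] at hg ⊢
  have hs : 0 < Real.arcosh (g.1.trace / 2) := Real.arcosh_pos (by linarith)
  have hcosh : Real.cosh (Real.arcosh (g.1.trace / 2)) = g.1.trace / 2 :=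
    Real.cosh_arcosh (by linarith)
  generalize Real.arcosh (g.1.trace / 2) = s at hs hcosh
  obtain ⟨p, hp⟩ := exists_mul_eq_mul_diag2 (g := g) (Real.exp_ne_zero s)
    (by rw [← Real.exp_neg]; exact (Real.exp_lt_exp.2 (by linarith)).ne')
    (by rw [← Real.exp_neg]; linarith [Real.cosh_eq s])
  refine ⟨2 * s, fun t => p • mk ⟨0, Real.exp t⟩ (Real.exp_pos t), by linarith, ?_,
    (isometry_smul ℍ p).comp (isometry_vertical_line 0), fun t => ?_⟩
  · rw [mul_div_cancel_left₀ _ two_ne_zero]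
    linarith
  · rw [← mul_smul, hp, mul_smul, diag2_exp_smul_vertical_line]

end Displacement

/-! ### Geodesic segments of the hyperbolic plane -/

section Geodesics

open UpperHalfPlane

theorem dist_eq_abs_of_cosh_dist_eq {X : Type*} [PseudoMetricSpace X] {x y : X} {r : ℝ}
    (h : Real.cosh (dist x y) = Real.cosh r) : dist x y = |r| := by
  rw [← abs_of_nonneg (dist_nonneg (x := x) (y := y))]
  exact le_antisymm (Real.cosh_le_cosh.1 h.le) (Real.cosh_le_cosh.1 h.ge)

/-- The half circle with centre `a` on the real axis and radius `r`, parametrized by arc length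
from its highest point. -/
noncomputable def halfCircle (a r : ℝ) (hr : 0 < r) (t : ℝ) : ℍ :=
  mk ⟨a + r * Real.sinh t / Real.cosh t, r / Real.cosh t⟩ (div_pos hr (Real.cosh_pos t))

theorem isometry_halfCircle (a r : ℝ) (hr : 0 < r) : Isometry (halfCircle a r hr) := by
  refine Isometry.of_dist_eq fun s t => ?_
  rw [Real.dist_eq]
  apply dist_eq_abs_of_cosh_dist_eq
  have hs := (Real.cosh_pos s).ne'
  have ht := (Real.cosh_pos t).ne'
  have hs2 := Real.cosh_sq s
  have ht2 := Real.cosh_sq t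
  rw [cosh_dist', Real.cosh_sub]
  simp only [halfCircle, mk_re, mk_im]
  field_simp
  linear_combination (- r ^ 2 * Real.cosh t ^ 2) * hs2 - r ^ 2 * Real.cosh s ^ 2 * ht2

theorem exists_halfCircle_eq {a r : ℝ} (hr : 0 < r) {z : ℍ}
    (h : (z.re - a) ^ 2 + z.im ^ 2 = r ^ 2) : ∃ t, halfCircle a r hr t = z := by
  have hcosh : Real.cosh (Real.arsinh ((z.re - a) / z.im)) = r / z.im := by
    rw [Real.cosh_arsinh, Real.sqrt_eq_iff_mul_self_eq (by positivity) (by positivity)]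
    field_simp
    linarith
  refine ⟨Real.arsinh ((z.re - a) / z.im), ?_⟩
  ext1
  apply Complex.ext <;> simp [halfCircle, hcosh, Real.sinh_arsinh] <;> field_simp
  ring

theorem exists_isometry_mem_range (z w : ℍ) :
    ∃ c : ℝ → ℍ, Isometry c ∧ z ∈ Set.range c ∧ w ∈ Set.range c := by
  by_cases h : z.re = w.re
  · refine ⟨_, isometry_vertical_line z.re, ⟨Real.log z.im, ?_⟩, ⟨Real.log w.im, ?_⟩⟩
    · ext1; apply Complex.ext <;> simp [Real.exp_log z.im_pos]
    · ext1; apply Complex.ext <;> simp [Real.exp_log w.im_pos, h]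
  · have hne : z.re - w.re ≠ 0 := sub_ne_zero.2 h
    -- the point of the real axis at equal Euclidean distance from `z` and `w`
    set a := (z.re ^ 2 + z.im ^ 2 - w.re ^ 2 - w.im ^ 2) / (2 * (z.re - w.re)) with ha
    have hpos : 0 < (z.re - a) ^ 2 + z.im ^ 2 := by positivity
    have hr := Real.sqrt_pos.2 hpos
    have hsq := Real.sq_sqrt hpos.le
    refine ⟨_, isometry_halfCircle a _ hr, exists_halfCircle_eq hr hsq.symm,
      exists_halfCircle_eq hr ?_⟩
    rw [hsq, ha]
    field_simp
    ring

theorem exists_isometry_apply_zero_eq {X : Type*} [PseudoMetricSpace X] {c : ℝ → X}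
    (hc : Isometry c) (s t : ℝ) :
    ∃ c' : ℝ → X, Isometry c' ∧ c' 0 = c s ∧ c' (dist (c s) (c t)) = c t := by
  rw [hc.dist_eq, Real.dist_eq]
  rcases le_total s t with h | h
  · refine ⟨fun u => c (s + u), hc.comp (IsometryEquiv.addLeft s).isometry, by simp, ?_⟩
    rw [abs_of_nonpos (by linarith)]
    ring_nf
  · refine ⟨fun u => c (s - u), hc.comp (IsometryEquiv.subLeft s).isometry, by simp, ?_⟩
    rw [abs_of_nonneg (by linarith)]
    ring_nf

theorem exists_isometry_apply_dist_eq (z w : ℍ) :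
    ∃ c : ℝ → ℍ, Isometry c ∧ c 0 = z ∧ c (dist z w) = w := by
  obtain ⟨c, hc, ⟨s, rfl⟩, ⟨t, rfl⟩⟩ := exists_isometry_mem_range z w
  exact exists_isometry_apply_zero_eq hc s t

theorem dist_eq_abs_sub_of_dist_zero_eq {X : Type*} [PseudoMetricSpace X] {c : ℝ → X} {d : ℝ}
    (hc : LipschitzWith 1 c) (hd : dist (c 0) (c d) = d) {s t : ℝ} (hs : s ∈ Set.Icc 0 d)
    (ht : t ∈ Set.Icc 0 d) : dist (c s) (c t) = |s - t| := by
  wlog hst : s ≤ t generalizing s t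
  · rw [dist_comm, abs_sub_comm, this ht hs (le_of_not_ge hst)]
  have hle : ∀ u v, dist (c u) (c v) ≤ |u - v| := fun u v => by
    simpa [Real.dist_eq] using hc.dist_le_mul u v
  have h0s := hle 0 s
  have hsd := hle t d
  refine le_antisymm (hle s t) ?_
  rw [abs_of_nonpos (by linarith [hs.1])] at h0s
  rw [abs_of_nonpos (by linarith [ht.2])] at hsd
  rw [abs_of_nonpos (by linarith)]
  linarith [dist_triangle4 (c 0) (c s) (c t) (c d)]

theorem min_im_lt_im_of_dist_eq {a m b : ℍ} {e : ℝ} (he : 0 < e) (ham : dist a m = e)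
    (hmb : dist m b = e) (hab : dist a b = 2 * e) : min a.im b.im < m.im := by
  by_contra! hcon
  obtain ⟨ha, hb⟩ := le_min_iff.1 hcon
  have hm := m.im_pos
  have hC : 1 < Real.cosh e := Real.one_lt_cosh.2 he.ne'
  have h1 := cosh_dist' a m
  have h2 := cosh_dist' m b
  have h3 := cosh_dist' a b
  rw [ham] at h1
  rw [hmb] at h2
  rw [hab, Real.cosh_two_mul, Real.sinh_sq] at h3
  generalize Real.cosh e = C at *
  field_simp at h1 h2 h3
  have hCa : 0 < C * a.im - m.im := by nlinarith
  have hCb : 0 < C * b.im - m.im := by nlinarith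
  have hprod := mul_pos hCa hCb
  nlinarith [sq_nonneg (a.im - b.im), sq_nonneg ((a.re - m.re) + (b.re - m.re))]

end Geodesics

/-! ### The quotient as a hyperbolic surface -/

instance properlyDiscontinuousSMul_upperHalfPlane (Γ : Subgroup SL(2, ℤ)) :
    ProperlyDiscontinuousSMul Γ ℍ where
  finite_disjoint_inter_image hK hL := by
    have hfin := properlyDiscontinuousSL2ZRange.finite_disjoint_inter_image hK hL
    let f : Γ → (Matrix.SpecialLinearGroup.mapGL (n := Fin 2) (R := ℤ) ℝ).range :=
      fun g => ⟨_, g.1, rfl⟩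
    have hf : Function.Injective f := fun a b hab =>
      Subtype.ext (Matrix.SpecialLinearGroup.mapGL_injective (congrArg Subtype.val hab))
    exact (hfin.preimage hf.injOn).subset fun g hg => hg

instance isIsometricSMul_upperHalfPlane (Γ : Subgroup SL(2, ℤ)) : IsIsometricSMul Γ ℍ where
  isometry_smul g := Isometry.of_dist_eq (HypQuotient.dist_smul_smul g)

theorem im_smul_I_le_one (g : SL(2, ℤ)) : (g • UpperHalfPlane.I).im ≤ 1 := by
  have hdet := specialLinearGroup_two_det_eq g
  have hnormSq : Complex.normSq (UpperHalfPlane.denom g UpperHalfPlane.I) =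
      (g 1 1 ^ 2 + g 1 0 ^ 2 : ℤ) := by
    rw [ModularGroup.denom_apply, Complex.normSq_apply]
    simp [pow_two]
  have hrow : 0 < g 1 1 ^ 2 + g 1 0 ^ 2 := by
    by_contra! hle
    obtain ⟨h1, h0⟩ : g 1 1 = 0 ∧ g 1 0 = 0 := by constructor <;> nlinarith
    simp [h1, h0] at hdet
  rw [ModularGroup.im_smul_eq_div_normSq, hnormSq, UpperHalfPlane.I_im]
  exact div_le_one_of_le₀ (by exact_mod_cast hrow) (by positivity)

namespace HypQuotient

variable {Γ : Subgroup SL(2, ℤ)}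

theorem dist_proj_le (z w : ℍ) : dist (proj Γ z) (proj Γ w) ≤ dist z w := qdist_proj_le z w

theorem proj_smul (g : Γ) (z : ℍ) : proj Γ (g • z) = proj Γ z := proj_eq_iff.2 ⟨g, rfl⟩

theorem lipschitzWith_proj : LipschitzWith 1 (proj Γ) :=
  LipschitzWith.of_dist_le_mul fun z w => by simpa using dist_proj_le z w

theorem isOpenMap_proj : IsOpenMap (proj Γ) := isOpenMap_quotient_mk'_mul

theorem tendsto_dist_smul_cofinite (z w : ℍ) :
    Filter.Tendsto (fun g : Γ => dist z (g • w)) Filter.cofinite Filter.atTop := by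
  refine Filter.tendsto_atTop.2 fun r => ?_
  have hfin := ProperlyDiscontinuousSMul.finite_disjoint_inter_image (Γ := Γ)
    (isCompact_singleton (x := w)) (isCompact_closedBall z r)
  refine Filter.mem_cofinite.2 (hfin.subset fun g hg => ⟨g • w, ⟨w, rfl, rfl⟩, ?_⟩)
  rw [Metric.mem_closedBall, dist_comm]
  exact le_of_not_ge hg

theorem exists_dist_eq (z : ℍ) (q : HypQuotient Γ) :
    ∃ w, proj Γ w = q ∧ dist z w = dist (proj Γ z) q := by
  obtain ⟨w₀, rfl⟩ := proj_surjective q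
  obtain ⟨g, hg⟩ := (tendsto_dist_smul_cofinite (Γ := Γ) z w₀).exists_forall_le
  refine ⟨g • w₀, proj_smul g w₀, le_antisymm (not_lt.1 fun hlt => ?_) ?_⟩
  · obtain ⟨w, hw, hzw⟩ := exists_dist_lt hlt
    obtain ⟨g', rfl⟩ := proj_eq_iff.1 hw
    exact (hg g').not_gt hzw
  · rw [← proj_smul g w₀]
    exact dist_proj_le _ _

theorem exists_forall_le_dist_smul [IsCancelSMul Γ ℍ] (z : ℍ) :
    ∃ ε > 0, ∀ g : Γ, g ≠ 1 → ε ≤ dist z (g • z) := by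
  by_cases hne : ∃ g : Γ, g ≠ 1
  · obtain ⟨g₀, hg₀, hmin⟩ :=
      (tendsto_dist_smul_cofinite (Γ := Γ) z z).exists_within_forall_le (s := {g | g ≠ 1}) hne
    refine ⟨dist z (g₀ • z), dist_pos.2 fun h => hg₀ ?_, hmin⟩
    exact isCancelSMul_iff_eq_one_of_smul_eq.1 ‹_› g₀ z h.symm
  · exact ⟨1, one_pos, fun g hg => absurd ⟨g, hg⟩ hne⟩

theorem exists_ball_dist_proj_eq [IsCancelSMul Γ ℍ] (z : ℍ) :
    ∃ ε > 0, ∀ u ∈ Metric.ball z ε, ∀ v ∈ Metric.ball z ε,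
      dist (proj Γ u) (proj Γ v) = dist u v := by
  obtain ⟨ε, hε, hdispl⟩ := exists_forall_le_dist_smul (Γ := Γ) z
  refine ⟨ε / 4, by positivity, fun u hu v hv => le_antisymm (dist_proj_le _ _) ?_⟩
  obtain ⟨w, hw, hdist⟩ := exists_dist_eq u (proj Γ v)
  obtain ⟨g, rfl⟩ := proj_eq_iff.1 hw
  rw [← hdist]
  rcases eq_or_ne g 1 with rfl | hg
  · rw [one_smul]
  · have hquad := dist_triangle4 z u (g • v) (g • z)
    rw [dist_smul] at hquad
    rw [Metric.mem_ball, dist_comm] at hu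
    rw [Metric.mem_ball] at hv
    linarith [hdispl g hg, dist_triangle_right u v z, dist_comm u z]

/-- The local inverses of the projection `ℍ → Γ \ ℍ` that preserve distances; for a free action
they form a hyperbolic atlas of `Γ \ ℍ`. -/
def distCharts (Γ : Subgroup SL(2, ℤ)) : Set (OpenPartialHomeomorph (HypQuotient Γ) ℍ) :=
  {e | (∀ x ∈ e.source, proj Γ (e x) = x) ∧
    ∀ x ∈ e.source, ∀ y ∈ e.source, dist (e x) (e y) = dist x y}

theorem distCharts_symm_apply {e : OpenPartialHomeomorph (HypQuotient Γ) ℍ}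
    (he : e ∈ distCharts Γ) {w : ℍ} (hw : w ∈ e.target) : e.symm w = proj Γ w := by
  rw [← he.1 _ (e.map_target hw), e.right_inv hw]

theorem exists_mem_distCharts [IsCancelSMul Γ ℍ] (x : HypQuotient Γ) :
    ∃ e ∈ distCharts Γ, x ∈ e.source := by
  obtain ⟨z, rfl⟩ := proj_surjective x
  obtain ⟨ε, hε, hball⟩ := exists_ball_dist_proj_eq (Γ := Γ) z
  have hinj : Set.InjOn (proj Γ) (Metric.ball z ε) := fun u hu v hv huv => by
    rw [← dist_eq_zero, ← hball u hu v hv, huv, dist_self]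
  let e : OpenPartialHomeomorph ℍ (HypQuotient Γ) :=
    OpenPartialHomeomorph.ofContinuousOpen (hinj.toPartialEquiv _ _)
      lipschitzWith_proj.continuous.continuousOn isOpenMap_proj Metric.isOpen_ball
  refine ⟨e.symm, ⟨fun x hx => e.right_inv hx, fun x hx y hy => ?_⟩,
    e.map_source (x := z) (Metric.mem_ball_self hε)⟩
  rw [← hball _ (e.map_target hx) _ (e.map_target hy)]
  exact congrArg₂ dist (e.right_inv hx) (e.right_inv hy)

theorem distCharts_transition {e e' : OpenPartialHomeomorph (HypQuotient Γ) ℍ}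
    (he : e ∈ distCharts Γ) (he' : e' ∈ distCharts Γ) {z : ℍ}
    (hz : z ∈ (e.symm.trans e').source) :
    ∃ g : ℍ ≃ᵢ ℍ, ∀ᶠ w in 𝓝 z, (e.symm.trans e') w = g w := by
  obtain ⟨hze : z ∈ e.target, hze' : e.symm z ∈ e'.source⟩ := hz
  obtain ⟨g, hg⟩ := proj_eq_iff.1 ((he'.1 _ hze').trans (distCharts_symm_apply he hze))
  refine ⟨IsometryEquiv.constSMul g, ?_⟩
  have hmem : ∀ᶠ w in 𝓝 z, g • w ∈ e'.target :=
    (continuous_const_smul g).continuousAt.eventually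
      (e'.open_target.mem_nhds (by simpa only [hg] using e'.map_source hze'))
  filter_upwards [hmem, e.open_target.mem_nhds hze] with w hw' hw
  change e' (e.symm w) = g • w
  rw [distCharts_symm_apply he hw, ← proj_smul g w, ← distCharts_symm_apply he' hw',
    e'.right_inv hw']

instance properSpace : ProperSpace (HypQuotient Γ) where
  isCompact_closedBall p r := by
    obtain ⟨z, rfl⟩ := proj_surjective p
    refine ((isCompact_closedBall z r).image lipschitzWith_proj.continuous).of_isClosed_subset
      Metric.isClosed_closedBall fun q hq => ?_
    obtain ⟨w, hw, hdist⟩ := exists_dist_eq z q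
    refine ⟨w, ?_, hw⟩
    rwa [Metric.mem_closedBall, dist_comm, hdist, dist_comm]

theorem exists_segment (p q : HypQuotient Γ) : ∃ c : ℝ → HypQuotient Γ, c 0 = p ∧
    c (dist p q) = q ∧ ∀ s ∈ Set.Icc 0 (dist p q), ∀ t ∈ Set.Icc 0 (dist p q),
      dist (c s) (c t) = |s - t| := by
  obtain ⟨z, rfl⟩ := proj_surjective p
  obtain ⟨w, rfl, hdist⟩ := exists_dist_eq z q
  obtain ⟨c, hc, rfl, hw⟩ := exists_isometry_apply_dist_eq z w
  rw [hdist] at hw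
  have hlip : LipschitzWith 1 (proj Γ ∘ c) := by simpa using lipschitzWith_proj.comp hc.lipschitz
  refine ⟨proj Γ ∘ c, rfl, congrArg (proj Γ) hw, fun s hs t ht => ?_⟩
  exact dist_eq_abs_sub_of_dist_zero_eq hlip (by simp only [Function.comp_apply, hw]) hs ht

theorem isHyperbolicSurface [IsCancelSMul Γ ℍ] : IsHyperbolicSurface (HypQuotient Γ) where
  t2 := t2Space_of_properlyDiscontinuousSMul_of_t2Space
  secondCountable := ContinuousConstSMul.secondCountableTopology
  connected := Quotient.instConnectedSpace
  complete := inferInstance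
  exists_segment := exists_segment
  exists_atlas := ⟨distCharts Γ, exists_mem_distCharts, fun _ he => he.2,
    fun _ he _ he' _ hz => distCharts_transition he he' hz⟩

theorem not_compactSpace (Γ : Subgroup SL(2, ℤ)) : ¬ CompactSpace (HypQuotient Γ) := by
  intro hcompact
  obtain ⟨C, hC⟩ := Metric.isBounded_iff.1 (isCompact_univ (X := HypQuotient Γ)).isBounded
  let z : ℍ := UpperHalfPlane.mk ⟨0, Real.exp (C + 1)⟩ (Real.exp_pos _)
  obtain ⟨w, hw, hdist⟩ := exists_dist_eq z (proj Γ UpperHalfPlane.I)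
  obtain ⟨g, rfl⟩ := proj_eq_iff.1 hw
  have hbound := hC (Set.mem_univ (proj Γ z)) (Set.mem_univ (proj Γ UpperHalfPlane.I))
  rw [← hdist] at hbound
  have hlog := (UpperHalfPlane.dist_log_im_le z (g • UpperHalfPlane.I)).trans hbound
  have hlog_nonpos := Real.log_nonpos (g • UpperHalfPlane.I).im_pos.le (im_smul_I_le_one g)
  rw [Real.dist_eq, show Real.log z.im = C + 1 from Real.log_exp _] at hlog
  linarith [le_abs_self (C + 1 - Real.log (g • UpperHalfPlane.I).im)]

theorem isQuotientCoveringMap_proj [IsCancelSMul Γ ℍ] : IsQuotientCoveringMap (proj Γ) Γ :=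
  isQuotientCoveringMap_quotientMk_of_properlyDiscontinuousSMul

end HypQuotient

/-! ### Closed curves and deck transformations -/

section QuotientCovering

variable {E X G : Type*} [TopologicalSpace E] [TopologicalSpace X] [Group G] [MulAction G E]
  {p : E → X} {g : G} {L : ℝ}

theorem smul_eq_of_comp_eq {A : Type*} [TopologicalSpace A] [PreconnectedSpace A]
    (hp : IsQuotientCoveringMap p G) {c c' : A → E} (hc : Continuous c) (hc' : Continuous c')
    (h : p ∘ c = p ∘ c') {a : A} (ha : g • c a = c' a) (b : A) : g • c b = c' b := by
  have hlift : p ∘ (fun b => g • c b) = p ∘ c' := by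
    rw [← h]
    exact funext fun b => hp.map_smul g
  exact congrFun (hp.isCoveringMap.eq_of_comp_eq ((hp.continuous_const_smul g).comp hc) hc' hlift
    a ha) b

theorem eq_one_of_nullhomotopic (hp : IsQuotientCoveringMap p G) {α : C(AddCircle L, X)}
    (hα : α.Nullhomotopic) {c : C(ℝ, E)} (hc : ∀ t : ℝ, p (c t) = α t) (hg : g • c 0 = c L) :
    g = 1 := by
  obtain ⟨y, ⟨F⟩⟩ := hα
  have cov := hp.isCoveringMap
  let H : C(unitInterval × ℝ, X) := ⟨fun q => F (q.1, (q.2 : AddCircle L)), by fun_prop⟩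
  have hH0 : ∀ t, H (0, t) = p (c t) := fun t => (F.apply_zero _).trans (hc t).symm
  let K := cov.liftHomotopy H c hH0
  have hK : ∀ q, p (K q) = H q := fun q => congrFun (cov.liftHomotopy_lifts H c hH0) q
  have hK0 : ∀ t, K (0, t) = c t := cov.liftHomotopy_zero H c hH0
  have hK1 : K (1, 0) = K (1, L) :=
    cov.const_of_comp (g := fun t => K (1, t)) (by fun_prop)
      (fun t t' => by rw [hK, hK]; exact (F.apply_one t).trans (F.apply_one t').symm) 0 L
  have hends : ∀ s, g • K (s, 0) = K (s, L) :=
    smul_eq_of_comp_eq hp (by fun_prop) (by fun_prop)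
      (funext fun s => by simp [hK, H, AddCircle.coe_period]) (a := 0) (by rw [hK0, hK0, hg])
  exact isCancelSMul_iff_eq_one_of_smul_eq.1 hp.isCancelSMul g (K (1, 0)) ((hends 1).trans hK1.symm)

theorem exists_lift_smul_eq (hp : IsQuotientCoveringMap p G) (α : C(AddCircle L, X)) :
    ∃ (g : G) (c : C(ℝ, E)), (∀ t : ℝ, p (c t) = α t) ∧ ∀ t, g • c t = c (t + L) := by
  let f : C(ℝ, X) := ⟨fun t => α t, by fun_prop⟩
  obtain ⟨e, he⟩ := hp.surjective (f 0)
  obtain ⟨c, ⟨-, hc⟩, -⟩ := hp.isCoveringMap.existsUnique_continuousMap_lifts f 0 e he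
  have hlift : ∀ t : ℝ, p (c t) = α t := congrFun hc
  have hper : ∀ t, p (c (t + L)) = p (c t) := fun t => by simp [hlift]
  obtain ⟨g, hg⟩ := hp.apply_eq_iff_mem_orbit.1 (hper 0)
  exact ⟨g, c, hlift, smul_eq_of_comp_eq hp c.continuous (by fun_prop)
    (funext fun t => (hper t).symm) hg⟩

end QuotientCovering

/-! ### Local geodesics -/

/-- `c` is a local geodesic parametrized by arc length: near every parameter, `c` preserves
distances. A closed geodesic of length `L` is one with period `L > 0`. -/
def IsLocalGeodesic {X : Type*} [PseudoMetricSpace X] (c : ℝ → X) : Prop :=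
  ∀ t : ℝ, ∃ ε > 0, ∀ s ∈ Metric.ball t ε, ∀ s' ∈ Metric.ball t ε, dist (c s) (c s') = |s - s'|

namespace IsLocalGeodesic

variable {X Y : Type*} [PseudoMetricSpace X] [PseudoMetricSpace Y] {c : ℝ → X} {a b L : ℝ}

theorem of_isometry (hc : Isometry c) : IsLocalGeodesic c :=
  fun _ => ⟨1, one_pos, fun s _ s' _ => hc.dist_eq s s'⟩

theorem isometry_comp (hc : IsLocalGeodesic c) {f : X → Y} (hf : Isometry f) :
    IsLocalGeodesic (f ∘ c) := fun t => by
  obtain ⟨ε, hε, h⟩ := hc t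
  exact ⟨ε, hε, fun s hs s' hs' => (hf.dist_eq _ _).trans (h s hs s' hs')⟩

protected theorem continuous (hc : IsLocalGeodesic c) : Continuous c := by
  refine continuous_iff_continuousAt.2 fun t => Metric.continuousAt_iff.2 fun ε hε => ?_
  obtain ⟨δ, hδ, h⟩ := hc t
  refine ⟨min ε δ, lt_min hε hδ, fun s hs => ?_⟩
  rw [h s (hs.trans_le (min_le_right _ _)) t (Metric.mem_ball_self hδ), ← Real.dist_eq]
  exact hs.trans_le (min_le_left _ _)

theorem dist_le (hc : IsLocalGeodesic c) (hab : a ≤ b) : dist (c a) (c b) ≤ b - a := by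
  have hcont := hc.continuous
  suffices hsub : Set.Icc a b ⊆ {t | dist (c a) (c t) ≤ t - a} from hsub ⟨hab, le_rfl⟩
  apply IsClosed.Icc_subset_of_forall_mem_nhdsWithin
  · exact (isClosed_le (by fun_prop) (by fun_prop)).inter isClosed_Icc
  · simp
  · rintro t ⟨ht : dist (c a) (c t) ≤ t - a, -⟩
    obtain ⟨ε, hε, h⟩ := hc t
    filter_upwards [Ioo_mem_nhdsGT (lt_add_of_pos_right t hε)] with s hs
    have hts := h t (Metric.mem_ball_self hε) s
      (by rw [Real.ball_eq_Ioo]; exact ⟨by linarith [hs.1], hs.2⟩)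
    rw [abs_of_neg (by linarith [hs.1])] at hts
    change dist (c a) (c s) ≤ s - a
    linarith [dist_triangle (c a) (c t) (c s)]

-- A minimum of the height would contradict `min_im_lt_im_of_dist_eq`.
theorem not_periodic_im {c : ℝ → ℍ} (hc : IsLocalGeodesic c) (hL : 0 < L) :
    ¬ Function.Periodic (fun t => (c t).im) L := by
  intro hper
  have hcont : Continuous fun t => (c t).im := UpperHalfPlane.continuous_im.comp hc.continuous
  obtain ⟨t, -, hmin⟩ := isCompact_Icc.exists_isMinOn (Set.nonempty_Icc.2 hL.le) hcont.continuousOn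
  have hglobal : ∀ s, (c t).im ≤ (c s).im := fun s => by
    obtain ⟨s', hs', hss'⟩ := hper.exists_mem_Ico₀ hL s
    exact (hmin (Set.Ico_subset_Icc_self hs')).trans hss'.ge
  obtain ⟨ε, hε, h⟩ := hc t
  have hball : ∀ u ∈ Set.Icc (-(ε / 2)) (ε / 2), t + u ∈ Metric.ball t ε := fun u hu => by
    rw [Real.ball_eq_Ioo]
    exact ⟨by linarith [hu.1], by linarith [hu.2]⟩
  have hl := hball (-(ε / 2)) ⟨le_rfl, by linarith⟩
  have hm := Metric.mem_ball_self (x := t) hε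
  have hr := hball (ε / 2) ⟨by linarith, le_rfl⟩
  have hlt := min_im_lt_im_of_dist_eq (half_pos hε)
    ((h _ hl _ hm).trans (by rw [abs_of_neg] <;> linarith))
    ((h _ hm _ hr).trans (by rw [abs_of_neg] <;> linarith))
    ((h _ hl _ hr).trans (by rw [abs_of_neg] <;> linarith))
  exact hlt.not_ge (le_min (hglobal _) (hglobal _))

end IsLocalGeodesic

/-! ### Closed geodesics in the quotient -/

section Parabolic

theorem exists_mul_apply_one_eq {K : Type*} [Field K] {g : SL(2, K)} {e : K}
    (he : g.1.charpoly.IsRoot e) : ∃ p : SL(2, K), ∀ j, (p * g) 1 j = e * p 1 j := by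
  rw [Polynomial.IsRoot, Matrix.eval_charpoly] at he
  obtain ⟨v, hv, hvg⟩ := Matrix.exists_vecMul_eq_zero_iff.2 he
  have hcoprime : IsCoprime (v 0) (v 1) := by
    rcases Function.ne_iff.1 hv with ⟨i, hi⟩
    fin_cases i
    · exact ⟨(v 0)⁻¹, 0, by simpa using inv_mul_cancel₀ hi⟩
    · exact ⟨0, (v 1)⁻¹, by simpa using inv_mul_cancel₀ hi⟩
  obtain ⟨p, hp0, hp1⟩ := hcoprime.exists_SL2_row 1
  have hrow : p.1 1 = v := by ext j; fin_cases j <;> assumption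
  refine ⟨p, fun j => ?_⟩
  have hvj := congrFun hvg j
  rw [Matrix.vecMul_sub, Matrix.scalar_apply, Pi.sub_apply, Matrix.vecMul_diagonal] at hvj
  change Matrix.vecMul (p.1 1) g.1 j = e * p.1 1 j
  rw [hrow, mul_comm]
  exact (sub_eq_zero.1 hvj).symm

theorem exists_im_smul_smul_eq_of_abs_trace_eq_two {g : SL(2, ℝ)} (hg : |g.1.trace| = 2) :
    ∃ p : SL(2, ℝ), ∀ z : ℍ, (p • g • z).im = (p • z).im := by
  have htr : g.1.trace ^ 2 = 4 := by rw [← sq_abs, hg]; norm_num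
  obtain ⟨p, hp⟩ := exists_mul_apply_one_eq (g := g) (e := g.1.trace / 2) (by
    rw [Matrix.charpoly_fin_two, g.det_coe]
    simp only [Polynomial.IsRoot, Polynomial.eval_add, Polynomial.eval_sub, Polynomial.eval_mul,
      Polynomial.eval_pow, Polynomial.eval_X, Polynomial.eval_C]
    linear_combination -htr / 4)
  have he : g.1.trace / 2 * (g.1.trace / 2) = 1 := by linear_combination htr / 4
  refine ⟨p, fun z => ?_⟩
  rw [← mul_smul, im_specialLinearGroup_smul, im_specialLinearGroup_smul, hp, hp,
    Complex.ofReal_mul, Complex.ofReal_mul, mul_assoc, ← mul_add, Complex.normSq_mul,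
    Complex.normSq_ofReal, he, one_mul]

end Parabolic

namespace HypQuotient

variable {Γ : Subgroup SL(2, ℤ)} [IsCancelSMul Γ ℍ] {L : ℝ}

theorem isLocalGeodesic_proj_comp_iff {c : ℝ → ℍ} (hc : Continuous c) :
    IsLocalGeodesic (proj Γ ∘ c) ↔ IsLocalGeodesic c := by
  refine forall_congr' fun t => ?_
  obtain ⟨ε, hε, hball⟩ := exists_ball_dist_proj_eq (Γ := Γ) (c t)
  obtain ⟨δ, hδ, hcδ⟩ := Metric.continuous_iff.1 hc t ε hε
  have hdist : ∀ s ∈ Metric.ball t δ, ∀ s' ∈ Metric.ball t δ,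
      dist (proj Γ (c s)) (proj Γ (c s')) = dist (c s) (c s') := fun s hs s' hs' =>
    hball _ (hcδ s hs) _ (hcδ s' hs')
  constructor <;> rintro ⟨η, hη, h⟩ <;>
    refine ⟨min η δ, lt_min hη hδ, fun s hs s' hs' => ?_⟩ <;>
    rw [Metric.mem_ball, lt_min_iff] at hs hs'
  · rw [← hdist s hs.2 s' hs'.2]
    exact h s hs.1 s' hs'.1
  · exact (hdist s hs.2 s' hs'.2).trans (h s hs.1 s' hs'.1)

theorem exists_isProjectedAxis {γ : SL(2, ℤ)} (hγ : γ ∈ Γ) (hL : 0 < L) {c : ℝ → ℍ}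
    (hc : Isometry c) (hγc : ∀ t, γ • c t = c (t + L)) :
    ∃ α : C(AddCircle L, HypQuotient Γ), IsProjectedAxis γ α ∧ IsClosedGeodesic α := by
  have hper : Function.Periodic (proj Γ ∘ c) L := fun t => by
    rw [Function.comp_apply, ← hγc]
    exact proj_smul ⟨γ, hγ⟩ (c t)
  have hcont : Continuous hper.lift :=
    continuous_coinduced_dom.2 (lipschitzWith_proj.continuous.comp hc.continuous)
  exact ⟨⟨hper.lift, hcont⟩, ⟨c, hc, hγc, fun t => rfl⟩, hL,
    (isLocalGeodesic_proj_comp_iff hc.continuous).2 (.of_isometry hc)⟩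

theorem not_nullhomotopic_of_isProjectedAxis {γ : SL(2, ℤ)} (hγ : γ ∈ Γ) (hγ1 : γ ≠ 1)
    {α : C(AddCircle L, HypQuotient Γ)} (hα : IsProjectedAxis γ α) : ¬ α.Nullhomotopic := by
  obtain ⟨c, hc, hγc, hαc⟩ := hα
  intro hnull
  have h0 : γ • c 0 = c L := by rw [hγc, zero_add]
  have hone : (⟨γ, hγ⟩ : Γ) = 1 :=
    eq_one_of_nullhomotopic isQuotientCoveringMap_proj hnull (c := ⟨c, hc.continuous⟩)
      (fun t => (hαc t).symm) h0
  exact hγ1 (congrArg Subtype.val hone)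

theorem exists_isLocalGeodesic_lift {α : C(AddCircle L, HypQuotient Γ)}
    (hα : IsClosedGeodesic α) :
    ∃ γ ∈ Γ, ∃ c : ℝ → ℍ, IsLocalGeodesic c ∧ ∀ t, γ • c t = c (t + L) := by
  obtain ⟨γ, c, hc, hγc⟩ := exists_lift_smul_eq (isQuotientCoveringMap_proj (Γ := Γ)) α
  have hα' : IsLocalGeodesic (proj Γ ∘ c) := by
    rw [show proj Γ ∘ c = fun t : ℝ => α t from funext hc]
    exact hα.2
  exact ⟨γ, γ.2, c, (isLocalGeodesic_proj_comp_iff c.continuous).1 hα', hγc⟩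

-- A parabolic deck transformation would make a height along the lifted geodesic periodic.
theorem exists_abs_trace_le_of_isClosedGeodesic {α : C(AddCircle L, HypQuotient Γ)}
    (hα : IsClosedGeodesic α) :
    ∃ γ ∈ Γ, |γ.1.trace| ≠ 2 ∧ (|γ.1.trace| : ℝ) ≤ 2 * Real.cosh (L / 2) := by
  obtain ⟨γ, hγ, c, hc, hγc⟩ := exists_isLocalGeodesic_lift hα
  set g : SL(2, ℝ) := Matrix.SpecialLinearGroup.map (Int.castRingHom ℝ) γ
  have hgc : ∀ t, g • c t = c (t + L) := hγc
  have htr : g.1.trace = γ.1.trace := (AddMonoidHom.map_trace (Int.castRingHom ℝ) γ.1).symm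
  refine ⟨γ, hγ, fun h2 => ?_, ?_⟩
  · obtain ⟨p, hp⟩ := exists_im_smul_smul_eq_of_abs_trace_eq_two (g := g)
      (by rw [htr]; exact_mod_cast h2)
    exact (hc.isometry_comp (isometry_smul ℍ p)).not_periodic_im hα.1 fun t => by
      simp only [Function.comp_apply, ← hgc, hp]
  · have hdist : dist (c 0) (c L) ≤ L := by simpa using hc.dist_le hα.1.le
    have htrace := abs_trace_le_two_mul_cosh_half_dist_smul g (c 0)
    rw [hgc, zero_add, htr] at htrace
    refine htrace.trans (mul_le_mul_of_nonneg_left (Real.cosh_le_cosh.2 ?_) zero_le_two)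
    exact abs_le_abs_of_nonneg (by positivity) (by linarith)

theorem representsSystole_of_forall_abs_trace_le {γ : SL(2, ℤ)} (hγ : γ ∈ Γ)
    (h2 : 2 < |γ.1.trace|) (hmin : ∀ γ' ∈ Γ, |γ'.1.trace| ≠ 2 → |γ.1.trace| ≤ |γ'.1.trace|) :
    RepresentsSystole Γ γ := by
  have htr : (Matrix.SpecialLinearGroup.map (Int.castRingHom ℝ) γ).1.trace = γ.1.trace :=
    (AddMonoidHom.map_trace (Int.castRingHom ℝ) γ.1).symm
  obtain ⟨L, c, hL, hcosh, hc, hγc⟩ :=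
    exists_axis (g := Matrix.SpecialLinearGroup.map (Int.castRingHom ℝ) γ)
      (by rw [htr]; exact_mod_cast h2)
  rw [htr] at hcosh
  obtain ⟨α, hα, hgeo⟩ := exists_isProjectedAxis hγ hL hc hγc
  have hγ1 : γ ≠ 1 := by
    rintro rfl
    simp at h2
  have hnull := not_nullhomotopic_of_isProjectedAxis hγ hγ1 hα
  have hleast : IsLeast {L : ℝ | ∃ α : C(AddCircle L, HypQuotient Γ),
      IsClosedGeodesic α ∧ ¬ α.Nullhomotopic} L := by
    refine ⟨⟨α, hgeo, hnull⟩, ?_⟩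
    rintro L' ⟨α', hgeo', -⟩
    obtain ⟨γ', hγ', hne, hle⟩ := exists_abs_trace_le_of_isClosedGeodesic hgeo'
    have htrace : (|γ.1.trace| : ℝ) ≤ |(γ'.1.trace : ℝ)| := by exact_mod_cast hmin γ' hγ' hne
    have hLL' : Real.cosh (L / 2) ≤ Real.cosh (L' / 2) := by linarith
    rw [Real.cosh_le_cosh, abs_of_pos (half_pos hL), abs_of_pos (half_pos hgeo'.1)] at hLL'
    linarith
  exact ⟨hγ, L, α, hα, hgeo, hnull, hleast.csInf_eq.symm⟩

end HypQuotient

/-! ### Principal congruence subgroups -/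

section Gamma

open CongruenceSubgroup

variable {N : ℕ} {γ : SL(2, ℤ)}

theorem sq_dvd_two_sub_trace_of_mem_Gamma (hγ : γ ∈ Gamma N) :
    (N : ℤ) ^ 2 ∣ 2 - γ.1.trace := by
  have hdet : 2 - γ.1.trace = (1 - γ 0 0) * (1 - γ 1 1) - γ 0 1 * γ 1 0 := by
    rw [Matrix.trace_fin_two]
    linear_combination -specialLinearGroup_two_det_eq γ
  obtain ⟨h00, h01, h10, h11⟩ := Gamma_mem.1 hγ
  have hdiag : ∀ a : ℤ, (a : ZMod N) = 1 → (N : ℤ) ∣ 1 - a := fun a ha =>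
    (ZMod.intCast_eq_intCast_iff_dvd_sub a 1 N).1 (by simpa using ha)
  rw [hdet, sq]
  exact dvd_sub (mul_dvd_mul (hdiag _ h00) (hdiag _ h11))
    (mul_dvd_mul ((ZMod.intCast_zmod_eq_zero_iff_dvd _ N).1 h01)
      ((ZMod.intCast_zmod_eq_zero_iff_dvd _ N).1 h10))

theorem le_abs_trace_of_mem_Gamma (hγ : γ ∈ Gamma N) (h2 : |γ.1.trace| ≠ 2) :
    (N : ℤ) ^ 2 - 2 ≤ |γ.1.trace| := by
  have hne : 2 - γ.1.trace ≠ 0 := fun h => h2 (by rw [← sub_eq_zero.1 h, abs_two])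
  have hle := Int.le_of_dvd (abs_pos.2 hne)
    ((dvd_abs _ _).2 (sq_dvd_two_sub_trace_of_mem_Gamma hγ))
  linarith [(abs_sub 2 γ.1.trace).trans_eq (by rw [abs_two])]

theorem trace_ne_neg_two_of_mem_Gamma (hN : 3 ≤ N) (hγ : γ ∈ Gamma N) : γ.1.trace ≠ -2 := by
  intro h
  have hle := Int.le_of_dvd (by rw [h]; norm_num) (sq_dvd_two_sub_trace_of_mem_Gamma hγ)
  rw [h] at hle
  zify at hN
  nlinarith

theorem isCancelSMul_Gamma (hN : 3 ≤ N) : IsCancelSMul (Gamma N) ℍ := by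
  refine isCancelSMul_iff_eq_one_of_smul_eq.2 fun ⟨γ, hγ⟩ z hz => Subtype.ext ?_
  set g := Matrix.SpecialLinearGroup.map (Int.castRingHom ℝ) γ
  have htr : g.1.trace = γ.1.trace := (AddMonoidHom.map_trace (Int.castRingHom ℝ) γ.1).symm
  by_cases hg : g ∈ Subgroup.center SL(2, ℝ)
  · obtain ⟨r, hr, hrg⟩ := Matrix.SpecialLinearGroup.mem_center_iff.1 hg
    rcases sq_eq_one_iff.1 hr with rfl | rfl
    · have hg1 : g = 1 := Subtype.ext (hrg.symm.trans (map_one _))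
      exact Matrix.SpecialLinearGroup.map_intCast_injective (hg1.trans (map_one _).symm)
    · refine absurd ?_ (trace_ne_neg_two_of_mem_Gamma hN hγ)
      have htr2 : (γ.1.trace : ℝ) = -2 := by
        rw [← htr, ← hrg, Matrix.scalar_apply, Matrix.trace_diagonal, Finset.sum_const]
        simp
      exact_mod_cast htr2
  · have hlt : |γ.1.trace| < 2 := by
      have := abs_trace_lt_two_of_smul_eq hg hz
      rw [htr] at this
      exact_mod_cast this
    have hle := le_abs_trace_of_mem_Gamma hγ hlt.ne
    zify at hN
    nlinarith

theorem neg_sq_eq_one_sub_trace_smul {R : Type*} [CommRing R] (β : SL(2, R)) :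
    (-(β ^ 2)).1 = 1 - β.1.trace • β.1 := by
  nontriviality R
  have hch := Matrix.aeval_self_charpoly β.1
  rw [Matrix.charpoly_fin_two, β.det_coe] at hch
  simp only [map_add, map_sub, map_mul, map_pow, map_one, Polynomial.aeval_X, Polynomial.aeval_C,
    ← Algebra.smul_def] at hch
  rw [Matrix.SpecialLinearGroup.coe_neg, Matrix.SpecialLinearGroup.coe_pow, ← sub_eq_zero,
    ← neg_eq_zero, ← hch]
  abel

theorem neg_sq_mem_Gamma {β : SL(2, ℤ)} (h : (N : ℤ) ∣ β.1.trace) : -(β ^ 2) ∈ Gamma N := by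
  have h0 := (ZMod.intCast_zmod_eq_zero_iff_dvd _ N).2 h
  have happly : ∀ i j, (-(β ^ 2)) i j = (1 : Matrix (Fin 2) (Fin 2) ℤ) i j - β.1.trace * β i j :=
    fun i j => congrFun (congrFun (neg_sq_eq_one_sub_trace_smul β) i) j
  rw [Gamma_mem]
  refine ⟨?_, ?_, ?_, ?_⟩ <;> rw [happly] <;> push_cast <;> rw [h0] <;> simp

theorem trace_neg_sq {R : Type*} [CommRing R] (β : SL(2, R)) :
    (-(β ^ 2)).1.trace = 2 - β.1.trace ^ 2 := by
  rw [neg_sq_eq_one_sub_trace_smul, Matrix.trace_sub, Matrix.trace_one, Matrix.trace_smul, sq,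
    smul_eq_mul, Fintype.card_fin, Nat.cast_two]

end Gamma

/-! ### Fundamental domains of subgroups -/

section CosetTranslates

open MeasureTheory Pointwise

theorem eq_of_mul_inv_out_eq {G : Type*} [Group G] {K : Subgroup G} {k k' : K} {q q' : G ⧸ K}
    (h : (k : G) * q.out⁻¹ = k' * q'.out⁻¹) : k = k' := by
  have hinv : q.out * (k⁻¹ : K) = q'.out * (k'⁻¹ : K) := by simpa using congrArg (·⁻¹) h
  obtain rfl : q = q' := by
    have hmk := congrArg (QuotientGroup.mk (s := K)) hinv
    rwa [QuotientGroup.mk_mul_of_mem _ (Subtype.prop _),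
      QuotientGroup.mk_mul_of_mem _ (Subtype.prop _), QuotientGroup.out_eq',
      QuotientGroup.out_eq'] at hmk
  exact Subtype.ext (mul_right_cancel h)

variable {P α : Type*} [Group P] [MulAction P α] {G H : Subgroup P} {s : Set α}

/-- The union of the translates of `s` by inverses of representatives of the left cosets of `H`
in `G`. If `s` is a fundamental domain of `G`, it is one of `H ≤ G`. -/
noncomputable def cosetTranslates (G H : Subgroup P) (s : Set α) : Set α :=
  ⋃ q : G ⧸ H.subgroupOf G, (q.out)⁻¹ • s

variable [MeasurableSpace α] {μ : Measure α} [SMulInvariantMeasure G α μ]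

theorem isFundamentalDomain_cosetTranslates [MeasurableConstSMul G α] [Countable G]
    (hs : IsFundamentalDomain G s μ) (hHG : H ≤ G) :
    IsFundamentalDomain H (cosetTranslates G H s) μ where
  nullMeasurableSet := by
    have : Countable (G ⧸ H.subgroupOf G) :=
      Function.Surjective.countable QuotientGroup.mk_surjective
    exact NullMeasurableSet.iUnion fun q => hs.nullMeasurableSet_smul _
  ae_covers := by
    filter_upwards [hs.ae_covers] with x ⟨g, hg⟩
    obtain ⟨h, hh⟩ := QuotientGroup.mk_out_eq_mul (H.subgroupOf G) g
    refine ⟨⟨(h⁻¹ : G), inv_mem (Subgroup.mem_subgroupOf.1 h.2)⟩,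
      Set.mem_iUnion.2 ⟨(g : G ⧸ H.subgroupOf G), ?_⟩⟩
    rw [Set.mem_smul_set_iff_inv_smul_mem, inv_inv, hh]
    change (g * (h : G)) • ((h : G)⁻¹ • x) ∈ s
    rwa [smul_smul, mul_inv_cancel_right]
  aedisjoint h h' hne := by
    have : Countable (G ⧸ H.subgroupOf G) :=
      Function.Surjective.countable QuotientGroup.mk_surjective
    simp only [Function.onFun, cosetTranslates, Set.smul_set_iUnion]
    refine AEDisjoint.iUnion_left_iff.2 fun q => AEDisjoint.iUnion_right_iff.2 fun q' => ?_
    let k : H.subgroupOf G := ⟨⟨h, hHG h.2⟩, h.2⟩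
    let k' : H.subgroupOf G := ⟨⟨h', hHG h'.2⟩, h'.2⟩
    change AEDisjoint μ ((k : G) • (q.out⁻¹ • s)) ((k' : G) • (q'.out⁻¹ • s))
    rw [smul_smul, smul_smul]
    refine hs.aedisjoint fun heq => hne (Subtype.ext ?_)
    exact congrArg (fun k : H.subgroupOf G => ((k : G) : P)) (eq_of_mul_inv_out_eq heq)

theorem measure_cosetTranslates_le [Finite (G ⧸ H.subgroupOf G)] :
    μ (cosetTranslates G H s) ≤ H.relIndex G * μ s := by
  have := Fintype.ofFinite (G ⧸ H.subgroupOf G)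
  refine (measure_iUnion_le _).trans ?_
  simp only [measure_smul]
  rw [tsum_fintype, Finset.sum_const, Finset.card_univ, nsmul_eq_mul, Subgroup.relIndex,
    Subgroup.index, Nat.card_eq_fintype_card]

end CosetTranslates

section TransformationGroup

open MeasureTheory

variable (Γ : Subgroup SL(2, ℤ))

theorem transformationGroup_eq_map :
    transformationGroup Γ = Γ.map (MulAction.toPermHom SL(2, ℤ) ℍ) := by
  ext g
  constructor
  · rintro ⟨γ, rfl⟩
    exact ⟨γ, γ.2, rfl⟩
  · rintro ⟨γ, hγ, rfl⟩
    exact ⟨⟨γ, hγ⟩, rfl⟩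

theorem transformationGroup_le_top : transformationGroup Γ ≤ transformationGroup ⊤ := by
  rw [transformationGroup_eq_map, transformationGroup_eq_map]
  exact Subgroup.map_mono le_top

theorem relIndex_transformationGroup_dvd_index :
    (transformationGroup Γ).relIndex (transformationGroup ⊤) ∣ Γ.index := by
  rw [transformationGroup_eq_map, transformationGroup_eq_map, Subgroup.relIndex_map_map,
    top_sup_eq, Subgroup.relIndex_top_right]
  exact Subgroup.index_dvd_of_le le_sup_left

instance countable_specialLinearGroup_int : Countable SL(2, ℤ) :=
  Function.Injective.countable (f := fun (g : SL(2, ℤ)) (i j : Fin 2) => g i j)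
    fun a b h => Matrix.SpecialLinearGroup.ext a b fun i j => congrFun₂ h i j

instance countable_transformationGroup : Countable (transformationGroup Γ) :=
  (MulAction.toPermHom Γ ℍ).rangeRestrict_surjective.countable

instance measurableConstSMul_transformationGroup :
    MeasurableConstSMul (transformationGroup Γ) ℍ where
  measurable_const_smul := by
    rintro ⟨_, γ, rfl⟩
    exact (continuous_const_smul γ).measurable

instance smulInvariantMeasure_transformationGroup :
    SMulInvariantMeasure (transformationGroup Γ) ℍ volume where
  measure_preimage_smul := by
    rintro ⟨_, γ, rfl⟩ s -
    exact measure_preimage_smul volume (Matrix.SpecialLinearGroup.mapGL ℝ (γ : SL(2, ℤ))) s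

end TransformationGroup

/-! ### The area of the modular surface -/

section ModularSurface

open MeasureTheory UpperHalfPlane
open scoped Modular Pointwise

theorem volume_eq_zero_iff_volume_coe_image {s : Set ℍ} :
    volume s = 0 ↔ volume ((↑) '' s : Set ℂ) = 0 := by
  have hmeas : Measurable fun z : ℍ =>
      (((1 / NNReal.mk z.im z.im_pos.le : NNReal) ^ 2 : NNReal) : ENNReal) := by
    have : Measurable fun z : ℍ => NNReal.mk z.im z.im_pos.le :=
      continuous_im.measurable.subtype_mk
    fun_prop
  have hsupport :
      {z : ℍ | (((1 / NNReal.mk z.im z.im_pos.le : NNReal) ^ 2 : NNReal) : ENNReal) ≠ 0} =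
        Set.univ := by
    refine Set.eq_univ_of_forall fun z => ?_
    have him : NNReal.mk z.im z.im_pos.le ≠ 0 := fun h => z.im_pos.ne' (congrArg NNReal.toReal h)
    exact ENNReal.coe_ne_zero.2 (pow_ne_zero 2 (one_div_ne_zero him))
  rw [volume_def, withDensity_apply_eq_zero hmeas, hsupport, Set.univ_inter,
    measurableEmbedding_coe.comap_apply]

theorem volume_fd_diff_fdo : volume (𝒟 \ 𝒟ᵒ) = 0 := by
  rw [volume_eq_zero_iff_volume_coe_image]
  have hline (a : ℝ) : volume {z : ℂ | z.re = a} = 0 := by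
    rw [← Complex.frontier_setOfPred_re_le]
    exact (convex_halfSpace_re_le _).addHaar_frontier volume
  have hcircle : volume (Metric.sphere (0 : ℂ) 1) = 0 := Measure.addHaar_sphere _ _ _
  refine measure_mono_null ?_
    (measure_union_null (measure_union_null (hline (1 / 2)) (hline (-(1 / 2)))) hcircle)
  rintro _ ⟨z, ⟨⟨hnormSq, hre⟩, hz⟩, rfl⟩
  by_cases hone : Complex.normSq z = 1
  · right
    rw [mem_sphere_zero_iff_norm]
    rw [Complex.normSq_eq_norm_sq] at hone
    exact (pow_eq_one_iff_of_nonneg (norm_nonneg _) two_ne_zero).1 hone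
  · left
    have hre' : |z.re| = 1 / 2 := by
      by_contra hne
      exact hz ⟨lt_of_le_of_ne hnormSq (Ne.symm hone), lt_of_le_of_ne hre hne⟩
    exact eq_or_eq_neg_of_abs_eq hre'

theorem isFundamentalDomain_fd : IsFundamentalDomain (transformationGroup ⊤) 𝒟 := by
  refine IsFundamentalDomain.mk'' ModularGroup.isClosed_fd.measurableSet.nullMeasurableSet
    (Filter.Eventually.of_forall fun z => ?_) ?_ fun g =>
      (measurePreserving_smul g (volume : Measure ℍ)).quasiMeasurePreserving
  · obtain ⟨γ, hγ⟩ := ModularGroup.exists_smul_mem_fd z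
    exact ⟨⟨_, ⟨γ, Subgroup.mem_top γ⟩, rfl⟩, hγ⟩
  · intro g hg
    have hsub : g • 𝒟 ∩ 𝒟 ⊆ 𝒟 \ 𝒟ᵒ := fun z hz => ⟨hz.2, fun hzo => hg ?_⟩
    · exact measure_mono_null hsub volume_fd_diff_fdo
    have hgz := Set.mem_smul_set_iff_inv_smul_mem.1 hz.1
    rw [← inv_eq_one]
    generalize g⁻¹ = k at hgz ⊢
    obtain ⟨_, γ, rfl⟩ := k
    have hγz : (γ : SL(2, ℤ)) • z ∈ 𝒟 := hgz
    refine Subtype.ext (Equiv.ext fun w => ?_)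
    change (γ : SL(2, ℤ)) • w = w
    rcases ModularGroup.eq_one_or_neg_one_of_mem_fdo_mem_fd hzo hγz with h | h
    · rw [h, one_smul]
    · rw [h, ModularGroup.SL_neg_smul, one_smul]

theorem volume_upperHalfPlane_ne_zero : (volume : Measure ℍ) ≠ 0 := by
  rw [← Measure.measure_univ_ne_zero, Ne, volume_eq_zero_iff_volume_coe_image, Set.image_univ]
  exact (isOpenEmbedding_coe.isOpen_range.measure_pos volume (Set.range_nonempty _)).ne'

theorem setLIntegral_Ioi_one_div_nnnorm_sq_lt_top {a : ℝ} (ha : 0 < a) :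
    ∫⁻ y in Set.Ioi a, (((1 / ‖y‖₊) ^ 2 : NNReal) : ENNReal) < ⊤ := by
  refine lt_of_le_of_lt (le_of_eq ?_)
    (integrableOn_Ioi_rpow_of_lt (a := -2) (by norm_num) ha).hasFiniteIntegral
  refine setLIntegral_congr_fun measurableSet_Ioi fun y hy => ?_
  change _ = ((‖y ^ (-2 : ℝ)‖₊ : NNReal) : ENNReal)
  rw [Real.rpow_neg (ha.trans hy).le]
  simp

theorem volume_setOf_abs_re_le_and_lt_im_lt_top {a : ℝ} (ha : 0 < a) (b : ℝ) :
    volume {z : ℍ | |z.re| ≤ b ∧ a < z.im} < ⊤ := by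
  have hsub : ((↑) '' {z : ℍ | |z.re| ≤ b ∧ a < z.im} : Set ℂ) ⊆
      Complex.measurableEquivRealProd ⁻¹' (Set.Icc (-b) b ×ˢ Set.Ioi a) := by
    rintro _ ⟨z, hz, rfl⟩
    exact ⟨abs_le.1 hz.1, hz.2⟩
  rw [volume_eq_lintegral]
  refine (lintegral_mono_set hsub).trans_lt ?_
  have hprod := Complex.volume_preserving_equiv_real_prod.setLIntegral_comp_preimage_emb
    Complex.measurableEquivRealProd.measurableEmbedding
    (fun p : ℝ × ℝ => (((1 / ‖p.2‖₊) ^ 2 : NNReal) : ENNReal)) (Set.Icc (-b) b ×ˢ Set.Ioi a)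
  have hfubini := lintegral_prod_mul (μ := volume.restrict (Set.Icc (-b) b))
    (ν := volume.restrict (Set.Ioi a)) (f := fun _ => 1)
    (g := fun y : ℝ => (((1 / ‖y‖₊) ^ 2 : NNReal) : ENNReal)) (by fun_prop) (by fun_prop)
  rw [Measure.volume_eq_prod, ← Measure.prod_restrict] at hprod
  simp only [one_mul] at hfubini
  refine (hprod.trans hfubini).trans_lt
    (ENNReal.mul_lt_top ?_ (setLIntegral_Ioi_one_div_nnnorm_sq_lt_top ha))
  rw [setLIntegral_const, one_mul]
  exact measure_Icc_lt_top

theorem volume_fd_lt_top : volume 𝒟 < ⊤ := by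
  have hsub : 𝒟 ⊆ {z : ℍ | |z.re| ≤ 1 / 2 ∧ 1 / 2 < z.im} := fun z hz => ⟨hz.2, ?_⟩
  · exact (measure_mono hsub).trans_lt (volume_setOf_abs_re_le_and_lt_im_lt_top one_half_pos _)
  nlinarith [ModularGroup.three_le_four_mul_im_sq_of_mem_fd hz, z.im_pos]

theorem area_top : area ⊤ = volume 𝒟 := isFundamentalDomain_fd.covolume_eq_volume

theorem area_top_ne_zero : area ⊤ ≠ 0 := by
  rw [area_top]
  exact isFundamentalDomain_fd.measure_ne_zero volume_upperHalfPlane_ne_zero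

theorem area_top_ne_top : area ⊤ ≠ ⊤ := by
  rw [area_top]
  exact volume_fd_lt_top.ne

theorem isFundamentalDomain_cosetTranslates_fd (Γ : Subgroup SL(2, ℤ)) :
    IsFundamentalDomain (transformationGroup Γ)
      (cosetTranslates (transformationGroup ⊤) (transformationGroup Γ) 𝒟) :=
  isFundamentalDomain_cosetTranslates isFundamentalDomain_fd (transformationGroup_le_top Γ)

theorem hasFundamentalDomain_transformationGroup (Γ : Subgroup SL(2, ℤ)) :
    HasFundamentalDomain (transformationGroup Γ) ℍ :=
  (isFundamentalDomain_cosetTranslates_fd Γ).hasFundamentalDomain _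

theorem area_le_index_mul_area_top (Γ : Subgroup SL(2, ℤ)) [Γ.FiniteIndex] :
    area Γ ≤ Γ.index * area ⊤ := by
  have hdvd := relIndex_transformationGroup_dvd_index Γ
  have hindex : Γ.index ≠ 0 := Subgroup.FiniteIndex.index_ne_zero
  have : Finite (transformationGroup ⊤ ⧸
      (transformationGroup Γ).subgroupOf (transformationGroup ⊤)) :=
    Nat.finite_of_card_ne_zero (ne_zero_of_dvd_ne_zero hindex hdvd)
  rw [area_top, area, (isFundamentalDomain_cosetTranslates_fd Γ).covolume_eq_volume]
  refine measure_cosetTranslates_le.trans ?_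
  gcongr
  exact Nat.le_of_dvd (Nat.pos_of_ne_zero hindex) hdvd

end ModularSurface

/-! ### The index of the principal congruence subgroup -/

section Index

variable {R : Type*} [CommRing R]

theorem exists_apply_one_eq_add_mul {k x : SL(2, R)} (h : ∀ i, x i 0 = k i 0) :
    ∃ t, ∀ i, x i 1 = k i 1 + t * k i 0 := by
  have hk := specialLinearGroup_two_det_eq k
  have hx := specialLinearGroup_two_det_eq x
  rw [h, h] at hx
  refine ⟨k 1 1 * x 0 1 - k 0 1 * x 1 1, fun i => ?_⟩
  fin_cases i
  · change x 0 1 = k 0 1 + (k 1 1 * x 0 1 - k 0 1 * x 1 1) * k 0 0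
    linear_combination k 0 1 * hx - x 0 1 * hk
  · change x 1 1 = k 1 1 + (k 1 1 * x 0 1 - k 0 1 * x 1 1) * k 1 0
    linear_combination k 1 1 * hx - x 1 1 * hk

theorem specialLinearGroup_two_col_zero_ne_zero [Nontrivial R] (g : SL(2, R)) :
    (fun i => g i 0) ≠ 0 := by
  intro h
  have hdet := specialLinearGroup_two_det_eq g
  rw [congrFun h 0, congrFun h 1] at hdet
  simp at hdet

theorem card_setOf_col_zero_eq_le [Finite R] (v : Fin 2 → R) :
    Nat.card {g : SL(2, R) // (fun i => g i 0) = v} ≤ Nat.card R := by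
  rcases isEmpty_or_nonempty {g : SL(2, R) // (fun i => g i 0) = v} with hv | ⟨⟨k, rfl⟩⟩
  · simp
  · choose t ht using fun x : {g : SL(2, R) // (fun i => g i 0) = fun i => k i 0} =>
      exists_apply_one_eq_add_mul (congrFun x.2)
    refine Nat.card_le_card_of_injective t fun x y hxy => Subtype.ext ?_
    refine Matrix.SpecialLinearGroup.ext _ _ fun i j => ?_
    fin_cases j
    · exact congrFun (x.2.trans y.2.symm) i
    · exact (ht x i).trans (by rw [hxy]; exact (ht y i).symm)

theorem card_specialLinearGroup_two_lt (R : Type*) [CommRing R] [Finite R] [Nontrivial R] :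
    Nat.card SL(2, R) < Nat.card R ^ 3 := by
  classical
  have := Fintype.ofFinite R
  let col (g : SL(2, R)) : {v : Fin 2 → R // v ≠ 0} :=
    ⟨fun i => g i 0, specialLinearGroup_two_col_zero_ne_zero g⟩
  have hfibre (v) : Finset.card {g | col g = v} ≤ Nat.card R := by
    refine le_of_eq_of_le ?_ (card_setOf_col_zero_eq_le v.1)
    rw [Nat.card_eq_fintype_card, Fintype.card_subtype]
    simp only [col, Subtype.ext_iff]
  have hcols : Nat.card {v : Fin 2 → R // v ≠ 0} < Nat.card R ^ 2 := by
    rw [Nat.card_eq_fintype_card, Nat.card_eq_fintype_card]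
    exact (Fintype.card_subtype_lt (x := 0) (by simp)).trans_eq (by simp)
  calc Nat.card SL(2, R) = (Finset.univ : Finset SL(2, R)).card := Nat.card_eq_fintype_card
    _ ≤ Nat.card R * (Finset.univ : Finset {v : Fin 2 → R // v ≠ 0}).card :=
      Finset.card_le_mul_card_image_of_maps_to (fun g _ => Finset.mem_univ (col g)) _
        fun v _ => hfibre v
    _ = Nat.card R * Nat.card {v : Fin 2 → R // v ≠ 0} := by
      rw [Nat.card_eq_fintype_card (α := {v : Fin 2 → R // v ≠ 0}), Finset.card_univ]
    _ < Nat.card R * Nat.card R ^ 2 := Nat.mul_lt_mul_of_pos_left hcols Nat.card_pos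
    _ = Nat.card R ^ 3 := by ring

theorem index_Gamma_lt {N : ℕ} (hN : 2 ≤ N) : (CongruenceSubgroup.Gamma N).index < N ^ 3 := by
  have : NeZero N := ⟨by omega⟩
  have : Fact (1 < N) := ⟨hN⟩
  rw [CongruenceSubgroup.Gamma, Subgroup.index_ker]
  refine (Nat.card_le_card_of_injective _ Subtype.val_injective).trans_lt ?_
  simpa using card_specialLinearGroup_two_lt (ZMod N)

theorem area_Gamma_lt {N : ℕ} (hN : 2 ≤ N) :
    area (CongruenceSubgroup.Gamma N) < area ⊤ * (N : ENNReal) ^ 3 := by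
  have : NeZero N := ⟨by omega⟩
  refine (area_le_index_mul_area_top _).trans_lt ?_
  rw [mul_comm]
  refine ENNReal.mul_lt_mul_right area_top_ne_zero area_top_ne_top ?_
  exact_mod_cast index_Gamma_lt hN

end Index

theorem mainTheorem4_general (N : ℕ) (hN : 3 ≤ N) :
    (∀ γ ∈ CongruenceSubgroup.Gamma N, |(γ : Matrix (Fin 2) (Fin 2) ℤ).trace| ≠ 2 →
      (N : ℤ) ^ 2 - 2 ≤ |(γ : Matrix (Fin 2) (Fin 2) ℤ).trace|) ∧
    (∀ β : SL(2, ℤ), ((β : Matrix (Fin 2) (Fin 2) ℤ).trace = N ∨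
        (β : Matrix (Fin 2) (Fin 2) ℤ).trace = -N) →
      -(β ^ 2) ∈ CongruenceSubgroup.Gamma N ∧
      RepresentsSystole (CongruenceSubgroup.Gamma N) (-(β ^ 2))) ∧
    (ProperlyDiscontinuousSMul (CongruenceSubgroup.Gamma N) ℍ ∧
      (∀ γ ∈ CongruenceSubgroup.Gamma N, γ ≠ 1 → ∀ z : ℍ, γ • z ≠ z) ∧
      IsHyperbolicSurface (HypQuotient (CongruenceSubgroup.Gamma N)) ∧
      ¬ CompactSpace (HypQuotient (CongruenceSubgroup.Gamma N)) ∧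
      MeasureTheory.HasFundamentalDomain
        (transformationGroup (CongruenceSubgroup.Gamma N)) ℍ ∧
      MeasureTheory.HasFundamentalDomain (transformationGroup ⊤) ℍ ∧
      area (CongruenceSubgroup.Gamma N) < area ⊤ * (N : ENNReal) ^ 3) := by
  have hfree := isCancelSMul_Gamma hN
  refine ⟨fun γ hγ h => le_abs_trace_of_mem_Gamma hγ h, fun β hβ => ?_, inferInstance,
    fun γ hγ h1 z hz => ?_, HypQuotient.isHyperbolicSurface, HypQuotient.not_compactSpace _,
    hasFundamentalDomain_transformationGroup _, hasFundamentalDomain_transformationGroup _,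
    area_Gamma_lt (by omega)⟩
  · have hmem : -(β ^ 2) ∈ CongruenceSubgroup.Gamma N :=
      neg_sq_mem_Gamma (by rcases hβ with h | h <;> simp [h])
    have hlarge : 2 < (N : ℤ) ^ 2 - 2 := by
      zify at hN
      nlinarith
    have htr : |(-(β ^ 2)).1.trace| = (N : ℤ) ^ 2 - 2 := by
      rw [trace_neg_sq, sq_eq_sq_iff_eq_or_eq_neg.2 hβ, abs_of_nonpos (by linarith), neg_sub]
    refine ⟨hmem, HypQuotient.representsSystole_of_forall_abs_trace_le hmem ?_ ?_⟩ <;> rw [htr]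
    · exact hlarge
    · exact fun γ hγ h => le_abs_trace_of_mem_Gamma hγ h
  · have hone : (⟨γ, hγ⟩ : CongruenceSubgroup.Gamma N) = 1 :=
      isCancelSMul_iff_eq_one_of_smul_eq.1 hfree _ z hz
    exact h1 (congrArg Subtype.val hone)

theorem mainTheorem4 (N : ℕ) (hN : 5 ≤ N) :
    -- (a)
    (∀ γ ∈ CongruenceSubgroup.Gamma N, |(γ : Matrix (Fin 2) (Fin 2) ℤ).trace| ≠ 2 →
      (N : ℤ) ^ 2 - 2 ≤ |(γ : Matrix (Fin 2) (Fin 2) ℤ).trace|) ∧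
    -- (b)
    (∀ β : SL(2, ℤ), ((β : Matrix (Fin 2) (Fin 2) ℤ).trace = N ∨
        (β : Matrix (Fin 2) (Fin 2) ℤ).trace = -N) →
      -(β ^ 2) ∈ CongruenceSubgroup.Gamma N ∧
      RepresentsSystole (CongruenceSubgroup.Gamma N) (-(β ^ 2))) ∧
    -- (c): `Γ(N)` acts properly discontinuously and without fixed points
    (ProperlyDiscontinuousSMul (CongruenceSubgroup.Gamma N) ℍ ∧
      (∀ γ ∈ CongruenceSubgroup.Gamma N, γ ≠ 1 → ∀ z : ℍ, γ • z ≠ z) ∧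
      -- the quotient is a non-compact hyperbolic surface
      IsHyperbolicSurface (HypQuotient (CongruenceSubgroup.Gamma N)) ∧
      ¬ CompactSpace (HypQuotient (CongruenceSubgroup.Gamma N)) ∧
      -- both areas are areas of actual fundamental domains, and they satisfy the inequality
      MeasureTheory.HasFundamentalDomain
        (transformationGroup (CongruenceSubgroup.Gamma N)) ℍ ∧
      MeasureTheory.HasFundamentalDomain (transformationGroup ⊤) ℍ ∧
      area (CongruenceSubgroup.Gamma N) < area ⊤ * (N : ENNReal) ^ 3) :=
  mainTheorem4_general N (by omega)
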